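/- Let $n\ge 2$, $s\in(0,1)$ and $p\in(1,\infty)$. Then there is a continuous map $\tilde f\colon[-1,1]^n\to\mathbb R^n$ belonging to the fractional Sobolev space $W^{s,p}([-1,1]^n,\mathbb R^n)$, i.e. $\tilde f\in L^p$ and $$\int_{[-1,1]^n}\int_{[-1,1]^n}\frac{|\tilde f(x)-\tilde f(y)|^p}{|x-y|^{n+sp}}\,dy\,dx<\infty ,$$ such that $\tilde f$ is (classically) differentiable at almost every $x\in[-1,1]^n$ with $\det\nabla\tilde f(x)>0$ for almost every $x$, such that $$\tilde f(x)=(-x_1,x_2,\dots,x_n)\quad\text{for every }x\in\partial[-1,1]^n,$$ and such that $\tilde f$ is not sense-preserving on $(-1,1)^n$. Here a continuous map $f\colon\Omega\to\mathbb R^n$ on an open set $\Omega\subset\mathbb R^n$ is called sense-preserving if the topological (Brouwer) degree satisfies $\deg(f,U,y)>0$ for every domain $U\subset\subset\Omega$ and every $y\in f(U)\setminus f(\partial U)$. -/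

import Mathlib

open MeasureTheory

noncomputable section

/-- The closed cube `[-1,1]ⁿ` in Euclidean `n`-space. -/
def closedCube (n : ℕ) : Set (EuclideanSpace ℝ (Fin n)) := {x | ∀ i, |x i| ≤ 1}

/-- The open cube `(-1,1)ⁿ` in Euclidean `n`-space. -/
def openCube (n : ℕ) : Set (EuclideanSpace ℝ (Fin n)) := {x | ∀ i, |x i| < 1}

/-- The reflection `(x₁, x₂, …, xₙ) ↦ (-x₁, x₂, …, xₙ)`. -/
def reflectFirst {n : ℕ} (x : EuclideanSpace ℝ (Fin n)) : EuclideanSpace ℝ (Fin n) :=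
  WithLp.toLp 2 fun i => if (i : ℕ) = 0 then -x i else x i

/-- The Gagliardo energy `∫_Ω ∫_Ω |f x - f y|^p / |x - y|^(n + s p) dy dx`. -/
def gagliardoEnergy {n m : ℕ} (s p : ℝ) (Ω : Set (EuclideanSpace ℝ (Fin n)))
    (f : EuclideanSpace ℝ (Fin n) → EuclideanSpace ℝ (Fin m)) : ENNReal :=
  ∫⁻ x in Ω, ∫⁻ y in Ω, ENNReal.ofReal (‖f x - f y‖ ^ p / ‖x - y‖ ^ ((n : ℝ) + s * p))

/-- Membership in the fractional (Sobolev–Slobodeckij) space `W^{s,p}(Ω, ℝᵐ)`. -/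
def MemFracSobolev {n m : ℕ} (s p : ℝ) (Ω : Set (EuclideanSpace ℝ (Fin n)))
    (f : EuclideanSpace ℝ (Fin n) → EuclideanSpace ℝ (Fin m)) : Prop :=
  MemLp f (ENNReal.ofReal p) (volume.restrict Ω) ∧ gagliardoEnergy s p Ω f < ⊤

/-- `y` is a regular value of `g` on `U`. -/
def IsRegularValueOn {n : ℕ} (g : EuclideanSpace ℝ (Fin n) → EuclideanSpace ℝ (Fin n))
    (U : Set (EuclideanSpace ℝ (Fin n))) (y : EuclideanSpace ℝ (Fin n)) : Prop :=
  ∀ x ∈ U, g x = y → (fderiv ℝ g x).det ≠ 0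

/-- The degree of a smooth map `g` on `U` at a regular value `y`: the sum of the signs of the
Jacobian over the preimages of `y` in `U`. -/
def smoothDegree {n : ℕ} (g : EuclideanSpace ℝ (Fin n) → EuclideanSpace ℝ (Fin n))
    (U : Set (EuclideanSpace ℝ (Fin n))) (y : EuclideanSpace ℝ (Fin n)) : ℤ :=
  ∑ᶠ x ∈ {x | x ∈ U ∧ g x = y}, ((SignType.sign (fderiv ℝ g x).det : SignType) : ℤ)

/-- `deg(f, U, y) = d`, for `U` bounded and open, `f` continuous on `closure U` and
`y ∉ f(∂U)`: the degree of `f` is that of any smooth map `g` with regular value `y` such that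
`|g - f| < dist(y, f(∂U))` on `closure U`. Such a `g` exists and the integer `d` does not depend
on it (homotopy invariance), so this relation is the graph of the Brouwer degree. -/
def HasBrouwerDegree {n : ℕ} (f : EuclideanSpace ℝ (Fin n) → EuclideanSpace ℝ (Fin n))
    (U : Set (EuclideanSpace ℝ (Fin n))) (y : EuclideanSpace ℝ (Fin n)) (d : ℤ) : Prop :=
  ∃ g : EuclideanSpace ℝ (Fin n) → EuclideanSpace ℝ (Fin n),
    ContDiff ℝ (⊤ : ℕ∞) g ∧
    (∀ x ∈ closure U, ‖g x - f x‖ < Metric.infDist y (f '' frontier U)) ∧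
    IsRegularValueOn g U y ∧
    smoothDegree g U y = d

/-- A continuous map `f` on the open set `Ω` is sense-preserving if `deg(f, U, y) > 0` for all
domains `U ⊂⊂ Ω` and all `y ∈ f(U) \ f(∂U)`. -/
def SensePreserving {n : ℕ} (f : EuclideanSpace ℝ (Fin n) → EuclideanSpace ℝ (Fin n))
    (Ω : Set (EuclideanSpace ℝ (Fin n))) : Prop :=
  ∀ U : Set (EuclideanSpace ℝ (Fin n)), IsOpen U → IsConnected U →
    IsCompact (closure U) → closure U ⊆ Ω →
    ∀ y ∈ f '' U \ f '' frontier U, ∀ d : ℤ, HasBrouwerDegree f U y d → 0 < d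

end

/-! A Cantor staircase of contraction ratio `r < 1/2` is Hölder continuous, with an exponent that
tends to `1` as `r → 1/2`, and has derivative `0` almost everywhere. Subtracting the identity and
extending periodically gives a small Hölder sawtooth with slope `-1` almost everywhere. Adding twice
its negative to the first component of the reflection turns the derivative of that component from
`-1` to `1`, so that the Jacobian determinant becomes `1`, while the map stays uniformly close to
the reflection and hence keeps its degree `-1` at the fixed point `0`. To keep the boundary values,
the sawtooth is replaced near the lateral faces by rescaled copies of higher and higher frequency,
which keep the slope but have vanishing amplitude; passing between the copies through a partition of
unity depending only on the other variables leaves the first partial derivative unchanged. A Hölder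
exponent larger than `s` yields the `W^{s,p}` bound. -/

open Filter Function Set Topology
open scoped NNReal ENNReal

section Holder

variable {X Y Z ι : Type*} {C C' r : ℝ≥0}

lemma holderWith_of_dist_le [PseudoMetricSpace X] [PseudoMetricSpace Y] {f : X → Y}
    (h : ∀ x y, dist (f x) (f y) ≤ C * dist x y ^ (r : ℝ)) : HolderWith C r f := by
  intro x y
  rw [edist_nndist, edist_nndist, ← ENNReal.coe_rpow_of_nonneg _ r.coe_nonneg,
    ← ENNReal.coe_mul, ENNReal.coe_le_coe, ← NNReal.coe_le_coe]
  exact_mod_cast h x y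

lemma holderWith_of_bounded_of_lipschitzWith [PseudoMetricSpace X] [PseudoMetricSpace Y]
    {D : ℝ≥0} {f : X → Y} (hD : ∀ x y, dist (f x) (f y) ≤ D) (hf : LipschitzWith C f)
    (hr : r ≤ 1) : HolderWith (max D C) r f :=
  have hf₀ : HolderWith D 0 f := holderWith_of_dist_le (by simpa using hD)
  hf₀.of_le_of_le (holderWith_one.2 hf) zero_le hr

lemma holderWith_of_tendsto [PseudoEMetricSpace X] [PseudoEMetricSpace Y] {l : Filter ι} [l.NeBot]
    {F : ι → X → Y} {f : X → Y} (hF : ∀ i, HolderWith C r (F i))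
    (hlim : ∀ x, Tendsto (F · x) l (𝓝 (f x))) : HolderWith C r f :=
  fun x y => le_of_tendsto' ((hlim x).edist (hlim y)) fun i => hF i x y

lemma holderWith_tsum [PseudoMetricSpace X] [NormedAddCommGroup Y] {C : ι → ℝ≥0} {f : ι → X → Y}
    (hC : Summable C) (hf : ∀ i, HolderWith (C i) r (f i)) (hsum : ∀ x, Summable (f · x)) :
    HolderWith (∑' i, C i) r fun x => ∑' i, f i x := by
  refine holderWith_of_dist_le fun x y => ?_
  rw [dist_eq_norm, ← (hsum x).tsum_sub (hsum y), NNReal.coe_tsum]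
  refine tsum_of_norm_bounded ((NNReal.summable_coe.2 hC).hasSum.mul_right _) fun i => ?_
  simpa only [dist_eq_norm] using (hf i).dist_le x y

lemma holderWith_uncurry [PseudoEMetricSpace X] [PseudoEMetricSpace Y] [PseudoEMetricSpace Z]
    {g : X → Y → Z} (h₁ : ∀ y, HolderWith C r (g · y)) (h₂ : ∀ x, HolderWith C' r (g x)) :
    HolderWith (C + C') r (uncurry g) := by
  rintro ⟨x, y⟩ ⟨x', y'⟩
  calc edist (g x y) (g x' y')
      ≤ edist (g x y) (g x' y) + edist (g x' y) (g x' y') := edist_triangle _ _ _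
    _ ≤ C * edist (x, y) (x', y') ^ (r : ℝ) + C' * edist (x, y) (x', y') ^ (r : ℝ) :=
        add_le_add ((h₁ y).edist_le_of_le (le_max_left _ _))
          ((h₂ x').edist_le_of_le (le_max_right _ _))
    _ = ↑(C + C') * edist (x, y) (x', y') ^ (r : ℝ) := by rw [ENNReal.coe_add, add_mul]

lemma holderOnWith_add [PseudoMetricSpace X] [SeminormedAddCommGroup Y] {f g : X → Y} {s : Set X}
    (hf : HolderOnWith C r f s) (hg : HolderOnWith C' r g s) : HolderOnWith (C + C') r (f + g) s :=
  HolderWith.restrict_iff.1 (hf.holderWith.add hg.holderWith)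

lemma dist_fract_one_le_of_floor_lt {x y : ℝ} (h : ⌊x⌋ < ⌊y⌋) :
    dist (Int.fract x) 1 ≤ dist x y := by
  have hfloor : (⌊x⌋ : ℝ) + 1 ≤ ⌊y⌋ := by exact_mod_cast h
  rw [dist_comm, dist_comm x, Real.dist_eq, Real.dist_eq,
    abs_of_nonneg (sub_nonneg.2 (Int.fract_lt_one x).le), Int.fract]
  exact (by linarith [Int.floor_le y] : _ ≤ y - x).trans (le_abs_self _)

lemma dist_zero_fract_le_of_floor_lt {x y : ℝ} (h : ⌊x⌋ < ⌊y⌋) :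
    dist 0 (Int.fract y) ≤ dist x y := by
  have hfloor : (⌊x⌋ : ℝ) + 1 ≤ ⌊y⌋ := by exact_mod_cast h
  rw [dist_comm, dist_comm x, Real.dist_eq, Real.dist_eq, sub_zero,
    abs_of_nonneg (Int.fract_nonneg y), Int.fract]
  exact (by linarith [Int.lt_floor_add_one x] : _ ≤ y - x).trans (le_abs_self _)

lemma holderWith_comp_fract [PseudoMetricSpace X] {v : ℝ → X} (hv : HolderWith C r v)
    (h01 : v 0 = v 1) : HolderWith (2 * C) r (v ∘ Int.fract) := by
  refine holderWith_of_dist_le fun x y => ?_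
  wlog hxy : x ≤ y generalizing x y
  · simpa only [dist_comm] using this y x (le_of_not_ge hxy)
  have hnonneg : 0 ≤ C * dist x y ^ (r : ℝ) := by positivity
  rw [NNReal.coe_mul, NNReal.coe_ofNat, mul_assoc, two_mul]
  rcases (Int.floor_mono hxy).eq_or_lt with hfloor | hfloor
  · have hdist : dist (Int.fract x) (Int.fract y) = dist x y := by
      rw [Int.fract, Int.fract, hfloor, dist_sub_right]
    have := hv.dist_le (Int.fract x) (Int.fract y)
    rw [hdist] at this
    exact this.trans (le_add_of_nonneg_left hnonneg)
  · -- Between `x` and `y` lie the integers `⌊x⌋ + 1` and `⌊y⌋`, where `v ∘ fract` takes one value.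
    have hx := dist_fract_one_le_of_floor_lt hfloor
    have hy := dist_zero_fract_le_of_floor_lt hfloor
    calc dist (v (Int.fract x)) (v (Int.fract y))
        ≤ dist (v (Int.fract x)) (v 1) + dist (v 0) (v (Int.fract y)) := by
          rw [h01]; exact dist_triangle _ _ _
      _ ≤ C * dist x y ^ (r : ℝ) + C * dist x y ^ (r : ℝ) :=
          add_le_add (hv.dist_le_of_le hx) (hv.dist_le_of_le hy)

end Holder

/-- A step from `0` to `1` across `[0, 1]`, the class of functions in which the Cantor function is
found as a fixed point; monotonicity is not part of the notion. -/
structure IsStaircase (f : ℝ → ℝ) : Prop where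
  eq_zero : ∀ ⦃x⦄, x ≤ 0 → f x = 0
  eq_one : ∀ ⦃x⦄, 1 ≤ x → f x = 1
  mem_Icc : ∀ x, f x ∈ Icc (0 : ℝ) 1

/-- The operator whose fixed point is the Cantor function of contraction ratio `r`: half of `f`
on `[0, r]` and half of `f` on `[1 - r, 1]`. -/
noncomputable def cantorMap (r : ℝ) (f : ℝ → ℝ) (x : ℝ) : ℝ :=
  (f (x / r) + f (1 - (1 - x) / r)) / 2

lemma isStaircase_projIcc : IsStaircase fun x => (projIcc (0 : ℝ) 1 zero_le_one x : ℝ) where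
  eq_zero x hx := by rw [projIcc_of_le_left _ hx]
  eq_one x hx := by rw [projIcc_of_right_le _ hx]
  mem_Icc x := Subtype.coe_prop _

lemma isStaircase_of_tendsto {ι : Type*} {l : Filter ι} [l.NeBot] {F : ι → ℝ → ℝ} {f : ℝ → ℝ}
    (hF : ∀ i, IsStaircase (F i)) (hlim : ∀ x, Tendsto (F · x) l (𝓝 (f x))) : IsStaircase f where
  eq_zero x hx := tendsto_nhds_unique (hlim x) (by simp [(hF _).eq_zero hx])
  eq_one x hx := tendsto_nhds_unique (hlim x) (by simp [(hF _).eq_one hx])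
  mem_Icc x := isClosed_Icc.mem_of_tendsto (hlim x) (.of_forall fun i => (hF i).mem_Icc x)

namespace IsStaircase

variable {f g : ℝ → ℝ} {r x : ℝ}

lemma dist_le_one (hf : IsStaircase f) (hg : IsStaircase g) (x y : ℝ) : dist (f x) (g y) ≤ 1 :=
  Real.dist_le_of_mem_Icc_01 (hf.mem_Icc x) (hg.mem_Icc y)

lemma hasDerivAt_zero_of_notMem (hf : IsStaircase f) (hx : x ∉ Icc (0 : ℝ) 1) :
    HasDerivAt f 0 x := by
  rw [Set.mem_Icc, not_and_or, not_le, not_le] at hx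
  rcases hx with hx | hx
  · refine (hasDerivAt_const x 0).congr_of_eventuallyEq ?_
    filter_upwards [Iio_mem_nhds hx] with y hy using hf.eq_zero (mem_Iio.1 hy).le
  · refine (hasDerivAt_const x 1).congr_of_eventuallyEq ?_
    filter_upwards [Ioi_mem_nhds hx] with y hy using hf.eq_one (mem_Ioi.1 hy).le

lemma cantorMap_of_le (hf : IsStaircase f) (hr : 0 < r) (hx : x ≤ 1 - r) :
    cantorMap r f x = f (x / r) / 2 := by
  have : 1 ≤ (1 - x) / r := by rw [one_le_div hr]; linarith
  rw [cantorMap, hf.eq_zero (sub_nonpos.2 this), add_zero]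

lemma cantorMap_of_ge (hf : IsStaircase f) (hr : 0 < r) (hx : r ≤ x) :
    cantorMap r f x = (1 + f (1 - (1 - x) / r)) / 2 := by
  rw [cantorMap, hf.eq_one ((one_le_div hr).2 hx)]

protected lemma cantorMap (hf : IsStaircase f) (hr : 0 < r) (hr1 : r ≤ 1) :
    IsStaircase (cantorMap r f) where
  eq_zero x hx := by
    rw [hf.cantorMap_of_le hr (by linarith), hf.eq_zero (div_nonpos_of_nonpos_of_nonneg hx hr.le),
      zero_div]
  eq_one x hx := by
    have : (1 - x) / r ≤ 0 := div_nonpos_of_nonpos_of_nonneg (by linarith) hr.le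
    rw [hf.cantorMap_of_ge hr (by linarith), hf.eq_one (by linarith)]
    norm_num
  mem_Icc x := by
    obtain ⟨hl₀, hl₁⟩ := hf.mem_Icc (x / r)
    obtain ⟨hr₀, hr₁⟩ := hf.mem_Icc (1 - (1 - x) / r)
    constructor <;> rw [cantorMap] <;> linarith

lemma dist_cantorMap_le (hf : IsStaircase f) (hg : IsStaircase g) (hr : 0 < r) (hr2 : r < 1 / 2)
    {B : ℝ} (h : ∀ x, dist (f x) (g x) ≤ B) (x : ℝ) :
    dist (cantorMap r f x) (cantorMap r g x) ≤ B / 2 := by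
  rcases le_total x (1 / 2) with hx | hx
  · rw [hf.cantorMap_of_le hr (by linarith), hg.cantorMap_of_le hr (by linarith), Real.dist_eq,
      ← sub_div, abs_div, abs_two]
    gcongr
    exact h _
  · rw [hf.cantorMap_of_ge hr (by linarith), hg.cantorMap_of_ge hr (by linarith), Real.dist_eq,
      ← sub_div, add_sub_add_left_eq_sub, abs_div, abs_two]
    gcongr
    exact h _

-- Two points at distance less than `1 - 2r` lie in the same half, where `cantorMap` rescales `f`.
lemma holderWith_cantorMap {K a : ℝ≥0} (hf : IsStaircase f) (hfa : HolderWith K a f) (hr : 0 < r)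
    (hr2 : r < 1 / 2) (hra : r ^ (a : ℝ) = 1 / 2) (hK : 1 ≤ K * (1 - 2 * r) ^ (a : ℝ)) :
    HolderWith K a (cantorMap r f) := by
  refine holderWith_of_dist_le fun x y => ?_
  wlog hxy : x ≤ y generalizing x y
  · simpa only [dist_comm] using this y x (le_of_not_ge hxy)
  have hscale {x' y' : ℝ} (h : dist x' y' = dist x y / r) :
      dist (f x') (f y') / 2 ≤ K * dist x y ^ (a : ℝ) := by
    have := hfa.dist_le x' y'
    rw [h, Real.div_rpow dist_nonneg hr.le, hra] at this
    linarith
  have hdist : dist x y = y - x := by rw [dist_comm, Real.dist_eq, abs_of_nonneg (by linarith)]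
  rcases le_or_gt (1 - 2 * r) (dist x y) with hfar | hnear
  · have hstair := hf.cantorMap hr (by linarith)
    calc dist (cantorMap r f x) (cantorMap r f y) ≤ 1 := hstair.dist_le_one hstair x y
      _ ≤ K * (1 - 2 * r) ^ (a : ℝ) := hK
      _ ≤ K * dist x y ^ (a : ℝ) := by gcongr; linarith
  rcases le_total y (1 - r) with hy | hy
  · rw [hf.cantorMap_of_le hr (hxy.trans hy), hf.cantorMap_of_le hr hy, Real.dist_eq, ← sub_div,
      abs_div, abs_two]
    refine hscale ?_
    rw [Real.dist_eq, Real.dist_eq, ← sub_div, abs_div, abs_of_pos hr]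
  · rw [hf.cantorMap_of_ge hr (by linarith), hf.cantorMap_of_ge hr (by linarith), Real.dist_eq,
      ← sub_div, add_sub_add_left_eq_sub, abs_div, abs_two]
    refine hscale ?_
    rw [dist_sub_left, Real.dist_eq, Real.dist_eq, ← sub_div, sub_sub_sub_cancel_left, abs_div,
      abs_of_pos hr, abs_sub_comm]

end IsStaircase

lemma exists_isStaircase_cantorMap_eq_self {K a : ℝ≥0} {r : ℝ} (hr : 0 < r) (hr2 : r < 1 / 2)
    (hra : r ^ (a : ℝ) = 1 / 2) (ha : a ≤ 1) (hK : 1 ≤ K)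
    (hKr : 1 ≤ K * (1 - 2 * r) ^ (a : ℝ)) :
    ∃ c : ℝ → ℝ, IsStaircase c ∧ HolderWith K a c ∧ cantorMap r c = c := by
  let F (k : ℕ) : ℝ → ℝ := (cantorMap r)^[k] fun x => projIcc (0 : ℝ) 1 zero_le_one x
  have hF_succ (k : ℕ) : F (k + 1) = cantorMap r (F k) := iterate_succ_apply' _ _ _
  have hF (k : ℕ) : IsStaircase (F k) := by
    induction k with
    | zero => exact isStaircase_projIcc
    | succ k ih => rw [hF_succ]; exact ih.cantorMap hr (by linarith)
  have hF_holder (k : ℕ) : HolderWith K a (F k) := by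
    induction k with
    | zero =>
      have hlip : LipschitzWith 1 (F 0) := LipschitzWith.projIcc zero_le_one
      refine (holderWith_of_bounded_of_lipschitzWith (D := 1) ?_ hlip ha).mono (by simpa using hK)
      simpa using (hF 0).dist_le_one (hF 0)
    | succ k ih => rw [hF_succ]; exact (hF k).holderWith_cantorMap ih hr hr2 hra hKr
  have hF_dist (k : ℕ) : ∀ x, dist (F k x) (F (k + 1) x) ≤ 1 * (1 / 2) ^ k := by
    induction k with
    | zero => simpa using fun x => (hF 0).dist_le_one (hF 1) x x
    | succ k ih =>
      intro x
      have := (hF k).dist_cantorMap_le (hF (k + 1)) hr hr2 ih x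
      rw [← hF_succ, ← hF_succ] at this
      exact this.trans_eq (by ring)
  have hF_lim (x : ℝ) : ∃ y, Tendsto (F · x) atTop (𝓝 y) :=
    cauchySeq_tendsto_of_complete
      (cauchySeq_of_le_geometric (1 / 2) 1 (by norm_num) (hF_dist · x))
  choose c hc using hF_lim
  refine ⟨c, isStaircase_of_tendsto hF hc, holderWith_of_tendsto hF_holder hc, funext fun x => ?_⟩
  refine tendsto_nhds_unique ?_ ((hc x).comp (tendsto_add_atTop_nat 1))
  simp only [comp_def, hF_succ]
  exact ((hc (x / r)).add (hc (1 - (1 - x) / r))).div_const 2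

section CantorDerivative

variable {c : ℝ → ℝ} {r x : ℝ}

lemma IsStaircase.hasDerivAt_zero_of_lt (hc : IsStaircase c) (hfix : cantorMap r c = c)
    (hr : 0 < r) (hx : x < 1 - r) (h : HasDerivAt c 0 (x / r)) : HasDerivAt c 0 x := by
  have hlocal : c =ᶠ[𝓝 x] fun y => c (y / r) / 2 := by
    filter_upwards [Iio_mem_nhds hx] with y hy
    rw [← hc.cantorMap_of_le hr (mem_Iio.1 hy).le, hfix]
  refine HasDerivAt.congr_of_eventuallyEq ?_ hlocal
  simpa [comp_def] using (h.comp x ((hasDerivAt_id x).div_const r)).div_const 2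

lemma IsStaircase.hasDerivAt_zero_of_gt (hc : IsStaircase c) (hfix : cantorMap r c = c)
    (hr : 0 < r) (hx : r < x) (h : HasDerivAt c 0 (1 - (1 - x) / r)) : HasDerivAt c 0 x := by
  have hlocal : c =ᶠ[𝓝 x] fun y => (1 + c (1 - (1 - y) / r)) / 2 := by
    filter_upwards [Ioi_mem_nhds hx] with y hy
    rw [← hc.cantorMap_of_ge hr (mem_Ioi.1 hy).le, hfix]
  refine HasDerivAt.congr_of_eventuallyEq ?_ hlocal
  have hinner : HasDerivAt (fun y => 1 - (1 - y) / r) (-(-1 / r)) x :=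
    (((hasDerivAt_id x).const_sub 1).div_const r).const_sub 1
  simpa [comp_def] using ((h.comp x hinner).const_add 1).div_const 2

/-- The set where `c` fails to have derivative zero is covered by its images under the
homotheties of ratio `r < 1 / 2` about `0` and `1`, so its measure is at most `2 * r` times
itself. -/
lemma IsStaircase.ae_hasDerivAt_zero (hc : IsStaircase c) (hfix : cantorMap r c = c)
    (hr : 0 < r) (hr2 : r < 1 / 2) : ∀ᵐ x, HasDerivAt c 0 x := by
  let Z : Set ℝ := {x | ¬ HasDerivAt c 0 x}
  have hcover : Z ⊆ AffineMap.homothety (0 : ℝ) r '' Z ∪ AffineMap.homothety (1 : ℝ) r '' Z := by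
    intro x hx
    rcases lt_or_ge x (1 - r) with hxr | hxr
    · refine .inl ⟨x / r, fun h => hx (hc.hasDerivAt_zero_of_lt hfix hr hxr h), ?_⟩
      simp [AffineMap.homothety_apply, mul_div_cancel₀ _ hr.ne']
    · refine .inr ⟨1 - (1 - x) / r, fun h => hx (hc.hasDerivAt_zero_of_gt hfix hr (by linarith) h),
        ?_⟩
      simp [AffineMap.homothety_apply, mul_div_cancel₀ _ hr.ne']
  have hfinite : volume Z ≠ ∞ :=
    measure_ne_top_of_subset (fun x hx => by_contra fun h => hx (hc.hasDerivAt_zero_of_notMem h))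
      (isCompact_Icc (a := (0 : ℝ)) (b := 1)).measure_lt_top.ne
  have hle : volume Z ≤ ENNReal.ofReal (2 * r) * volume Z := by
    calc volume Z ≤ volume (AffineMap.homothety (0 : ℝ) r '' Z) +
          volume (AffineMap.homothety (1 : ℝ) r '' Z) :=
          (measure_mono hcover).trans (measure_union_le _ _)
      _ = ENNReal.ofReal (2 * r) * volume Z := by
          simp only [Measure.addHaar_image_homothety, Module.finrank_self, pow_one, abs_of_pos hr]
          rw [← two_mul, ← mul_assoc, ENNReal.ofReal_mul zero_le_two, ENNReal.ofReal_ofNat]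
  rw [ae_iff]
  by_contra hZ
  have hlt : ENNReal.ofReal (2 * r) * volume Z < 1 * volume Z := by
    rw [ENNReal.mul_lt_mul_iff_left hZ hfinite, ENNReal.ofReal_lt_one]
    linarith
  exact (hle.trans_lt hlt).ne (one_mul _).symm

end CantorDerivative

lemma exists_isStaircase_holder_ae_hasDerivAt_zero {a : ℝ≥0} (ha : 0 < a) (ha1 : a < 1) :
    ∃ c : ℝ → ℝ, IsStaircase c ∧ MemHolder a c ∧ ∀ᵐ x, HasDerivAt c 0 x := by
  have ha' : (0 : ℝ) < a := ha
  let r : ℝ := (1 / 2) ^ (1 / (a : ℝ))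
  have hr : 0 < r := by positivity
  have hr2 : r < 1 / 2 := by
    have hexp : 1 < 1 / (a : ℝ) := (one_lt_div ha').2 (by exact_mod_cast ha1)
    simpa [r] using
      Real.rpow_lt_rpow_of_exponent_gt (x := (1 / 2 : ℝ)) (by norm_num) (by norm_num) hexp
  have hra : r ^ (a : ℝ) = 1 / 2 := by
    rw [← Real.rpow_mul (by norm_num), one_div_mul_cancel ha'.ne', Real.rpow_one]
  have hgap : 0 < (1 - 2 * r) ^ (a : ℝ) := Real.rpow_pos_of_pos (by linarith) _
  let K : ℝ≥0 := ⟨((1 - 2 * r) ^ (a : ℝ))⁻¹, by positivity⟩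
  have hK : 1 ≤ K :=
    (one_le_inv₀ hgap).2 (Real.rpow_le_one (by linarith) (by linarith) ha'.le)
  obtain ⟨c, hc, hc_holder, hfix⟩ :=
    exists_isStaircase_cantorMap_eq_self (K := K) hr hr2 hra ha1.le hK (inv_mul_cancel₀ hgap.ne').ge
  exact ⟨c, hc, hc_holder.memHolder, hc.ae_hasDerivAt_zero hfix hr hr2⟩

section Sawtooth

/-- The graph of `u` shrunk by the factor `b` in both directions, which keeps slopes while raising
the frequency and lowering the amplitude; for `b = 0` this is the zero function. -/
noncomputable def rescale (b : ℝ≥0) (u : ℝ → ℝ) (x : ℝ) : ℝ := u (b * x) / b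

variable {u : ℝ → ℝ} {b C a : ℝ≥0}

lemma rescale_natCast_intCast (hu : ∀ m : ℤ, u m = 0) (N : ℕ) (m : ℤ) : rescale N u m = 0 := by
  have := hu (N * m)
  push_cast at this
  rw [rescale, NNReal.coe_natCast, this, zero_div]

lemma abs_rescale_le {M : ℝ} (hu : ∀ x, |u x| ≤ M) (b : ℝ≥0) (x : ℝ) :
    |rescale b u x| ≤ M / b := by
  rw [rescale, abs_div, NNReal.abs_eq]
  gcongr
  exact hu _

lemma holderWith_rescale (hu : HolderWith C a u) (hb : 0 < b) :
    HolderWith (C * b ^ ((a : ℝ) - 1)) a (rescale b u) := by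
  have hb' : (0 : ℝ) < b := hb
  refine holderWith_of_dist_le fun x y => ?_
  calc dist (u (b * x) / b) (u (b * y) / b) = dist (u (b * x)) (u (b * y)) / b := by
        rw [Real.dist_eq, Real.dist_eq, ← sub_div, abs_div, NNReal.abs_eq]
    _ ≤ C * dist (b * x) (b * y) ^ (a : ℝ) / b := by gcongr; exact hu.dist_le _ _
    _ = ↑(C * b ^ ((a : ℝ) - 1)) * dist x y ^ (a : ℝ) := by
        rw [Real.dist_eq, ← mul_sub, abs_mul, NNReal.abs_eq, ← Real.dist_eq,
          Real.mul_rpow hb'.le dist_nonneg, NNReal.coe_mul, NNReal.coe_rpow,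
          Real.rpow_sub_one hb'.ne']
        ring

lemma ae_hasDerivAt_rescale {u' : ℝ} (hu : ∀ᵐ x, HasDerivAt u u' x) (hb : 0 < b) :
    ∀ᵐ x, HasDerivAt (rescale b u) u' x := by
  have hb' : (b : ℝ) ≠ 0 := NNReal.coe_ne_zero.2 hb.ne'
  filter_upwards [(Measure.quasiMeasurePreserving_smul volume hb').ae hu] with x hx
  have := (hx.comp x ((hasDerivAt_id x).const_mul (b : ℝ))).div_const (b : ℝ)
  rwa [mul_one, mul_div_cancel_right₀ _ hb'] at this

lemma ae_hasDerivAt_comp_fract {E : Type*} [NormedAddCommGroup E] [NormedSpace ℝ E] {v : ℝ → E}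
    {v' : E} (hv : ∀ᵐ x, HasDerivAt v v' x) : ∀ᵐ x, HasDerivAt (v ∘ Int.fract) v' x := by
  have hshift : ∀ᵐ x : ℝ, ∀ m : ℤ, HasDerivAt v v' (x - m) :=
    ae_all_iff.2 fun m => (measurePreserving_sub_right volume (m : ℝ)).quasiMeasurePreserving.ae hv
  have hne : ∀ᵐ x : ℝ, ∀ m : ℤ, x ≠ m := ae_all_iff.2 fun m => Measure.ae_ne volume _
  filter_upwards [hshift, hne] with x hx hxm
  have hlt : (⌊x⌋ : ℝ) < x := (Int.floor_le x).lt_of_ne (hxm _).symm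
  refine ((hx ⌊x⌋).comp_sub_const x _).congr_of_eventuallyEq ?_
  filter_upwards [Ioo_mem_nhds hlt (Int.lt_floor_add_one x)] with y hy
  rw [comp_apply, Int.fract, Int.floor_eq_iff.2 ⟨hy.1.le, hy.2⟩]

lemma exists_holder_ae_hasDerivAt_neg_one (ha : 0 < a) (ha1 : a < 1) {ε : ℝ} (hε : 0 < ε) :
    ∃ u : ℝ → ℝ, MemHolder a u ∧ (∀ x, |u x| ≤ ε) ∧ (∀ m : ℤ, u m = 0) ∧
      ∀ᵐ x, HasDerivAt u (-1) x := by
  obtain ⟨c, hc, hc_holder, hc_deriv⟩ := exists_isStaircase_holder_ae_hasDerivAt_zero ha ha1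
  have hramp := isStaircase_projIcc
  let v : ℝ → ℝ := c - fun x => (projIcc (0 : ℝ) 1 zero_le_one x : ℝ)
  have hv_fract : v ∘ Int.fract = (c - id) ∘ Int.fract := by
    funext x
    simp [v, projIcc_of_mem _ ⟨Int.fract_nonneg x, (Int.fract_lt_one x).le⟩]
  have hv0 : v 0 = 0 := by simp [v, hc.eq_zero le_rfl]
  have hv1 : v 1 = 0 := by simp [v, hc.eq_one le_rfl]
  have hv_bound (x : ℝ) : |(v ∘ Int.fract) x| ≤ 1 := hc.dist_le_one hramp _ _
  have hramp_holder : MemHolder a fun x => (projIcc (0 : ℝ) 1 zero_le_one x : ℝ) :=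
    (holderWith_of_bounded_of_lipschitzWith (D := 1) (hramp.dist_le_one hramp)
      (LipschitzWith.projIcc zero_le_one) ha1.le).memHolder
  obtain ⟨K, hv_holder⟩ : MemHolder a v := by
    simpa [v, sub_eq_add_neg] using hc_holder.add (hramp_holder.smul (c := (-1 : ℝ)))
  have hv_deriv : ∀ᵐ x, HasDerivAt (v ∘ Int.fract) (-1) x := by
    rw [hv_fract]
    refine ae_hasDerivAt_comp_fract ?_
    filter_upwards [hc_deriv] with x hx
    simpa using hx.sub (hasDerivAt_id x)
  obtain ⟨N, hN⟩ := exists_nat_one_div_lt hε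
  refine ⟨rescale ↑(N + 1) (v ∘ Int.fract),
    (holderWith_rescale (holderWith_comp_fract hv_holder (hv0.trans hv1.symm)) ?_).memHolder,
    fun x => (abs_rescale_le hv_bound _ x).trans ?_,
    rescale_natCast_intCast (by simp [hv0]) _, ae_hasDerivAt_rescale hv_deriv ?_⟩
  · positivity
  · exact_mod_cast hN.le
  · positivity

end Sawtooth

section DyadicBump

lemma exists_lipschitzWith_smoothTransition : ∃ L, LipschitzWith L Real.smoothTransition := by
  obtain ⟨L, hL⟩ := (Real.smoothTransition.contDiff (n := 1)).contDiffOn.exists_lipschitzOnWith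
    one_ne_zero (convex_Icc (0 : ℝ) 1) isCompact_Icc
  have hproj : Real.smoothTransition = Real.smoothTransition ∘ (↑) ∘ projIcc 0 1 zero_le_one :=
    funext fun _ => Real.smoothTransition.projIcc.symm
  exact ⟨L * 1, hproj ▸ hL.to_restrict.comp (.projIcc zero_le_one)⟩

/-- The `k`-th function of a smooth dyadic partition of unity on `(0, 1]`; its support in that
interval is contained in `[2⁻¹ * 2⁻ᵏ, 2 * 2⁻ᵏ]`. -/
noncomputable def dyadicBump (k : ℕ) (t : ℝ) : ℝ :=
  Real.smoothTransition (2 ^ (k + 1) * t - 1) - Real.smoothTransition (2 ^ k * t - 1)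

lemma abs_dyadicBump_le_one (k : ℕ) (t : ℝ) : |dyadicBump k t| ≤ 1 :=
  Real.dist_le_of_mem_Icc_01 ⟨Real.smoothTransition.nonneg _, Real.smoothTransition.le_one _⟩
    ⟨Real.smoothTransition.nonneg _, Real.smoothTransition.le_one _⟩

lemma dyadicBump_zero (k : ℕ) : dyadicBump k 0 = 0 := by simp [dyadicBump]

lemma dyadicBump_eq_zero {k : ℕ} {t : ℝ} (h : 2 ≤ 2 ^ k * t) : dyadicBump k t = 0 := by
  rw [dyadicBump, Real.smoothTransition.one_of_one_le, Real.smoothTransition.one_of_one_le,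
    sub_self]
  · linarith
  · rw [pow_succ]; linarith

lemma sum_dyadicBump {N : ℕ} {t : ℝ} (ht : t ≤ 1) (h : 2 ≤ 2 ^ N * t) :
    ∑ k ∈ Finset.range N, dyadicBump k t = 1 := by
  simp only [dyadicBump]
  rw [Finset.sum_range_sub (fun k => Real.smoothTransition (2 ^ k * t - 1)),
    Real.smoothTransition.one_of_one_le (by linarith),
    Real.smoothTransition.zero_of_nonpos (by simpa using ht), sub_zero]

lemma differentiable_dyadicBump (k : ℕ) : Differentiable ℝ (dyadicBump k) := by
  have := (Real.smoothTransition.contDiff (n := 1)).differentiable one_ne_zero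
  unfold dyadicBump
  fun_prop

lemma lipschitzWith_dyadicBump {L : ℝ≥0} (hL : LipschitzWith L Real.smoothTransition) (k : ℕ) :
    LipschitzWith (3 * L * 2 ^ k) (dyadicBump k) := by
  have hscale (j : ℕ) :
      LipschitzWith (L * 2 ^ j) fun t => Real.smoothTransition (2 ^ j * t - 1) :=
    hL.comp (.of_dist_le_mul fun t t' => by
      rw [dist_sub_right, Real.dist_eq, ← mul_sub, abs_mul, Real.dist_eq]
      simp)
  have hconst : 3 * L * 2 ^ k = L * 2 ^ (k + 1) + L * 2 ^ k := by ring
  exact hconst ▸ (hscale (k + 1)).sub (hscale k)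

end DyadicBump

/-- A superposition of rescaled copies of `u` in the second variable, with frequencies tending to
infinity and amplitudes tending to zero as the first variable `t` decreases to zero. -/
noncomputable def layeredSum (u : ℝ → ℝ) (t x : ℝ) : ℝ :=
  ∑' k : ℕ, dyadicBump k t * rescale (4 ^ k) u x

section LayeredSum

variable {u : ℝ → ℝ} {M C a : ℝ≥0}

lemma layeredSum_zero_left (u : ℝ → ℝ) (x : ℝ) : layeredSum u 0 x = 0 := by
  simp [layeredSum, dyadicBump_zero]

lemma layeredSum_intCast (hu : ∀ m : ℤ, u m = 0) (t : ℝ) (m : ℤ) : layeredSum u t m = 0 := by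
  have (k : ℕ) : rescale (4 ^ k) u m = 0 := by
    exact_mod_cast rescale_natCast_intCast hu (4 ^ k) m
  simp [layeredSum, this]

lemma abs_rescale_four_pow_le (hu : ∀ x, |u x| ≤ M) (k : ℕ) (x : ℝ) :
    |rescale (4 ^ k) u x| ≤ M * (1 / 4) ^ k :=
  (abs_rescale_le hu _ x).trans_eq (by push_cast; rw [one_div_pow, mul_one_div])

lemma norm_layer_le (hu : ∀ x, |u x| ≤ M) (k : ℕ) (t x : ℝ) :
    ‖dyadicBump k t * rescale (4 ^ k) u x‖ ≤ M * (1 / 4) ^ k := by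
  rw [norm_mul]
  exact (mul_le_of_le_one_left (norm_nonneg _) (abs_dyadicBump_le_one k t)).trans
    (abs_rescale_four_pow_le hu k x)

lemma hasSum_mul_one_fourth_pow (M : ℝ) : HasSum (fun k : ℕ => M * (1 / 4) ^ k) (M * (4 / 3)) := by
  have := (hasSum_geometric_of_lt_one (r := (1 / 4 : ℝ)) (by norm_num) (by norm_num)).mul_left M
  rwa [show (1 - 1 / 4 : ℝ)⁻¹ = 4 / 3 by norm_num] at this

lemma summable_layers (hu : ∀ x, |u x| ≤ M) (t x : ℝ) :
    Summable fun k : ℕ => dyadicBump k t * rescale (4 ^ k) u x :=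
  .of_norm_bounded (hasSum_mul_one_fourth_pow M).summable fun k => norm_layer_le hu k t x

lemma abs_layeredSum_le (hu : ∀ x, |u x| ≤ M) (t x : ℝ) : |layeredSum u t x| ≤ M * (4 / 3) :=
  tsum_of_norm_bounded (hasSum_mul_one_fourth_pow M) fun k => norm_layer_le hu k t x

lemma exists_lipschitzWith_layeredSum_left (hu : ∀ x, |u x| ≤ M) :
    ∃ A, ∀ x, LipschitzWith A (layeredSum u · x) := by
  obtain ⟨L, hL⟩ := exists_lipschitzWith_smoothTransition
  have hsum : Summable fun k : ℕ => 3 * L * M * (1 / 2 : ℝ≥0) ^ k :=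
    (NNReal.summable_geometric (by norm_num)).mul_left _
  refine ⟨∑' k : ℕ, 3 * L * M * (1 / 2) ^ k, fun x => holderWith_one.1 <|
    holderWith_tsum hsum (fun k => holderWith_one.2 ?_) fun t => summable_layers hu t x⟩
  refine LipschitzWith.of_dist_le_mul fun t t' => ?_
  calc dist (dyadicBump k t * rescale (4 ^ k) u x) (dyadicBump k t' * rescale (4 ^ k) u x)
      = dist (dyadicBump k t) (dyadicBump k t') * |rescale (4 ^ k) u x| := by
        rw [Real.dist_eq, Real.dist_eq, ← sub_mul, abs_mul]
    _ ≤ ↑(3 * L * 2 ^ k) * dist t t' * (M * (1 / 4) ^ k) := by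
        gcongr
        · exact (lipschitzWith_dyadicBump hL k).dist_le_mul t t'
        · exact abs_rescale_four_pow_le hu k x
    _ = ↑(3 * L * M * (1 / 2) ^ k) * dist t t' := by
        have : (1 / 2 : ℝ) ^ k = 2 ^ k * (1 / 4) ^ k := by rw [← mul_pow]; norm_num
        push_cast
        rw [this]
        ring

lemma exists_holderWith_layeredSum_right (hu : ∀ x, |u x| ≤ M) (hu_holder : HolderWith C a u)
    (ha : a < 1) : ∃ A, ∀ t, HolderWith A a (layeredSum u t) := by
  let q : ℝ≥0 := 4 ^ ((a : ℝ) - 1)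
  have hq : q < 1 :=
    NNReal.rpow_lt_one_of_one_lt_of_neg (by norm_num) (sub_neg.2 (by exact_mod_cast ha))
  refine ⟨∑' k : ℕ, C * q ^ k, fun t => holderWith_tsum
    ((NNReal.summable_geometric hq).mul_left C) (fun k => ?_) (summable_layers hu t)⟩
  have hlayer : HolderWith (C * q ^ k) a (rescale (4 ^ k) u) := by
    rw [← NNReal.rpow_natCast, ← NNReal.rpow_mul, mul_comm ((a : ℝ) - 1), NNReal.rpow_mul,
      NNReal.rpow_natCast]
    exact holderWith_rescale hu_holder (by positivity)
  refine holderWith_of_dist_le fun x x' => ?_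
  calc dist (dyadicBump k t * rescale (4 ^ k) u x) (dyadicBump k t * rescale (4 ^ k) u x')
      = |dyadicBump k t| * dist (rescale (4 ^ k) u x) (rescale (4 ^ k) u x') := by
        rw [Real.dist_eq, ← mul_sub, abs_mul, Real.dist_eq]
    _ ≤ dist (rescale (4 ^ k) u x) (rescale (4 ^ k) u x') :=
        mul_le_of_le_one_left dist_nonneg (abs_dyadicBump_le_one k t)
    _ ≤ ↑(C * q ^ k) * dist x x' ^ (a : ℝ) := hlayer.dist_le x x'

lemma memHolder_uncurry_layeredSum (hu : ∀ x, |u x| ≤ M) (hu_holder : MemHolder a u) (ha : a < 1) :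
    MemHolder a (uncurry (layeredSum u)) := by
  obtain ⟨C, hC⟩ := hu_holder
  obtain ⟨A₁, hA₁⟩ := exists_lipschitzWith_layeredSum_left hu
  obtain ⟨A₂, hA₂⟩ := exists_holderWith_layeredSum_right hu hC ha
  have hbdd (x t t' : ℝ) : dist (layeredSum u t x) (layeredSum u t' x) ≤ ↑(M * (8 / 3)) := by
    have := abs_le.1 (abs_layeredSum_le hu t x)
    have := abs_le.1 (abs_layeredSum_le hu t' x)
    push_cast
    exact abs_le.2 ⟨by linarith, by linarith⟩
  exact (holderWith_uncurry
    (fun x => holderWith_of_bounded_of_lipschitzWith (hbdd x) (hA₁ x) ha.le) hA₂).memHolder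

lemma layeredSum_eq_sum {N : ℕ} {t : ℝ} (ht : 0 ≤ t) (hN : 2 ≤ 2 ^ N * t) (x : ℝ) :
    layeredSum u t x = ∑ k ∈ Finset.range N, dyadicBump k t * rescale (4 ^ k) u x := by
  refine tsum_eq_sum fun k hk => ?_
  have hNk : (2 : ℝ) ^ N ≤ 2 ^ k := pow_le_pow_right₀ one_le_two (by simpa using hk)
  rw [dyadicBump_eq_zero (hN.trans (by gcongr)), zero_mul]

lemma hasFDerivAt_layer {k : ℕ} {t x : ℝ} (hx : HasDerivAt (rescale (4 ^ k) u) (-1) x) :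
    HasFDerivAt (fun z : ℝ × ℝ => dyadicBump k z.1 * rescale (4 ^ k) u z.2)
      ((deriv (dyadicBump k) t * rescale (4 ^ k) u x) • ContinuousLinearMap.fst ℝ ℝ ℝ -
        dyadicBump k t • ContinuousLinearMap.snd ℝ ℝ ℝ) (t, x) := by
  have hfst : HasFDerivAt (fun z : ℝ × ℝ => dyadicBump k z.1)
      (deriv (dyadicBump k) t • ContinuousLinearMap.fst ℝ ℝ ℝ) (t, x) :=
    HasDerivAt.comp_hasFDerivAt (f := Prod.fst) (t, x)
      (differentiable_dyadicBump k t).hasDerivAt hasFDerivAt_fst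
  have hsnd : HasFDerivAt (fun z : ℝ × ℝ => rescale (4 ^ k) u z.2)
      ((-1 : ℝ) • ContinuousLinearMap.snd ℝ ℝ ℝ) (t, x) :=
    HasDerivAt.comp_hasFDerivAt (f := Prod.snd) (t, x) hx hasFDerivAt_snd
  convert! hfst.mul hsnd using 1
  ext <;> simp [mul_comm]

lemma exists_hasFDerivAt_layeredSum {t x : ℝ} (ht : 0 < t) (ht1 : t ≤ 1)
    (hx : ∀ k : ℕ, HasDerivAt (rescale (4 ^ k) u) (-1) x) :
    ∃ A : ℝ, HasFDerivAt (uncurry (layeredSum u))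
      (A • ContinuousLinearMap.fst ℝ ℝ ℝ - ContinuousLinearMap.snd ℝ ℝ ℝ) (t, x) := by
  obtain ⟨N, hN⟩ := pow_unbounded_of_one_lt (4 / t) (one_lt_two (α := ℝ))
  rw [div_lt_iff₀ ht] at hN
  have hlocal : uncurry (layeredSum u) =ᶠ[𝓝 (t, x)] fun z =>
      ∑ k ∈ Finset.range N, dyadicBump k z.1 * rescale (4 ^ k) u z.2 := by
    filter_upwards [continuousAt_fst.eventually (Ioi_mem_nhds (half_lt_self ht))] with z hz
    have hle : t / 2 ≤ z.1 := (mem_Ioi.1 hz).le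
    refine layeredSum_eq_sum ((half_pos ht).le.trans hle) ?_ z.2
    calc (2 : ℝ) ≤ 2 ^ N * (t / 2) := by linarith
      _ ≤ 2 ^ N * z.1 := by gcongr
  have hsum := HasFDerivAt.fun_sum (u := Finset.range N) fun k _ =>
    hasFDerivAt_layer (t := t) (hx k)
  rw [Finset.sum_sub_distrib, ← Finset.sum_smul, ← Finset.sum_smul,
    sum_dyadicBump ht1 (by linarith), one_smul] at hsum
  exact ⟨_, hsum.congr_of_eventuallyEq hlocal⟩

end LayeredSum

section GagliardoEnergy

lemma rpow_norm_sub_div_le {E F : Type*} [NormedAddCommGroup E] [NormedAddCommGroup F] {f : E → F}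
    {x y : E} {C : ℝ≥0} {a p : ℝ} (hp : 0 < p) (h : ‖f x - f y‖ ≤ C * ‖x - y‖ ^ a) (q : ℝ) :
    ‖f x - f y‖ ^ p / ‖x - y‖ ^ q ≤ C ^ p * ‖x - y‖ ^ (-(q - a * p)) := by
  rcases eq_or_ne x y with rfl | hxy
  · rw [sub_self, norm_zero, Real.zero_rpow hp.ne', zero_div]
    positivity
  have hpos : 0 < ‖x - y‖ := norm_pos_iff.2 (sub_ne_zero.2 hxy)
  calc ‖f x - f y‖ ^ p / ‖x - y‖ ^ q
      ≤ (C * ‖x - y‖ ^ a) ^ p / ‖x - y‖ ^ q := by gcongr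
    _ = C ^ p * ‖x - y‖ ^ (-(q - a * p)) := by
        rw [Real.mul_rpow C.coe_nonneg (by positivity), ← Real.rpow_mul hpos.le, mul_div_assoc,
          ← Real.rpow_sub hpos, neg_sub]

lemma setLIntegral_sub_left_le {E : Type*} [NormedAddCommGroup E] [MeasurableSpace E]
    [BorelSpace E] {μ : Measure E} [μ.IsAddLeftInvariant] [μ.IsNegInvariant] {Ω : Set E}
    (hΩ : MeasurableSet Ω) {R : ℝ} (hR : Ω ⊆ Metric.ball 0 R) {x : E} (hx : x ∈ Ω)
    (G : E → ℝ≥0∞) :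
    ∫⁻ y in Ω, G (x - y) ∂μ ≤ ∫⁻ z in Metric.ball 0 (2 * R), G z ∂μ := by
  have hmem {y : E} (hy : y ∈ Ω) : x - y ∈ Metric.ball (0 : E) (2 * R) := by
    have hx' := mem_ball_zero_iff.1 (hR hx)
    have hy' := mem_ball_zero_iff.1 (hR hy)
    rw [mem_ball_zero_iff]
    linarith [norm_sub_le x y]
  calc ∫⁻ y in Ω, G (x - y) ∂μ
      = ∫⁻ y in Ω, (Metric.ball 0 (2 * R)).indicator G (x - y) ∂μ :=
        setLIntegral_congr_fun hΩ fun y hy => (indicator_of_mem (hmem hy) G).symm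
    _ ≤ ∫⁻ y, (Metric.ball 0 (2 * R)).indicator G (x - y) ∂μ := setLIntegral_le_lintegral _ _
    _ = ∫⁻ z, (Metric.ball 0 (2 * R)).indicator G z ∂μ := lintegral_sub_left_eq_self _ x
    _ = ∫⁻ z in Metric.ball 0 (2 * R), G z ∂μ :=
        lintegral_indicator Metric.isOpen_ball.measurableSet _

variable {n m : ℕ} {s p : ℝ} {a C : ℝ≥0} {Ω : Set (EuclideanSpace ℝ (Fin n))}
  {f : EuclideanSpace ℝ (Fin n) → EuclideanSpace ℝ (Fin m)}

lemma gagliardoEnergy_lt_top_of_holderOnWith (hn : 0 < n) (hp : 0 < p) (hsa : s < a)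
    (hf : HolderOnWith C a f Ω) (hΩ : MeasurableSet Ω) (hb : Bornology.IsBounded Ω) :
    gagliardoEnergy s p Ω f < ⊤ := by
  obtain ⟨R, hR⟩ := hb.subset_ball 0
  let g (z : EuclideanSpace ℝ (Fin n)) : ℝ := C ^ p * ‖z‖ ^ (-((n : ℝ) + s * p - a * p))
  have hg : IntegrableOn g (Metric.ball 0 (2 * R)) := by
    have hg_meas : Measurable g := by fun_prop
    refine integrableOn_ball_of_norm_le_rpow (C := C ^ p) (α := n + s * p - a * p)
      ?_ ?_ (.of_forall fun z => ?_) hg_meas.aestronglyMeasurable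
    · rw [finrank_euclideanSpace_fin]
      exact hn
    · rw [finrank_euclideanSpace_fin]
      nlinarith
    · exact (Real.norm_of_nonneg (by positivity)).le
  have hinner : ∀ x ∈ Ω,
      ∫⁻ y in Ω, ENNReal.ofReal (‖f x - f y‖ ^ p / ‖x - y‖ ^ ((n : ℝ) + s * p)) ≤
        ∫⁻ z in Metric.ball 0 (2 * R), ENNReal.ofReal (g z) := by
    intro x hx
    refine (setLIntegral_mono' hΩ fun y hy => ENNReal.ofReal_le_ofReal ?_).trans
      (setLIntegral_sub_left_le hΩ hR hx fun z => ENNReal.ofReal (g z))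
    refine rpow_norm_sub_div_le hp ?_ _
    simpa only [dist_eq_norm] using hf.dist_le hx hy
  calc gagliardoEnergy s p Ω f
      ≤ ∫⁻ _ in Ω, ∫⁻ z in Metric.ball 0 (2 * R), ENNReal.ofReal (g z) :=
        setLIntegral_mono' hΩ hinner
    _ = (∫⁻ z in Metric.ball 0 (2 * R), ENNReal.ofReal (g z)) * volume Ω := setLIntegral_const _ _
    _ < ⊤ := ENNReal.mul_lt_top hg.lintegral_lt_top hb.measure_lt_top

lemma memFracSobolev_of_holderOnWith (hn : 0 < n) (hp : 0 < p) (ha : 0 < a) (hsa : s < a)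
    (hf : HolderOnWith C a f Ω) (hΩ : IsCompact Ω) : MemFracSobolev s p Ω f := by
  have hcont : ContinuousOn f Ω := hf.continuousOn ha
  obtain ⟨M, hM⟩ := hΩ.exists_bound_of_continuousOn hcont
  have : IsFiniteMeasure (volume.restrict Ω) := isFiniteMeasure_restrict.2 hΩ.measure_lt_top.ne
  refine ⟨MemLp.of_bound (hcont.aestronglyMeasurable hΩ.measurableSet) M ?_,
    gagliardoEnergy_lt_top_of_holderOnWith hn hp hsa hf hΩ.measurableSet hΩ.isBounded⟩
  filter_upwards [ae_restrict_mem hΩ.measurableSet] with x hx using hM x hx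

end GagliardoEnergy

section Cube

variable {n : ℕ}

lemma closedCube_eq_preimage_Icc (n : ℕ) :
    closedCube n = EuclideanSpace.equiv (Fin n) ℝ ⁻¹' Icc (-1) 1 := by
  ext x
  simp only [closedCube, abs_le, mem_preimage, mem_Icc, Pi.le_def, ← forall_and]
  rfl

lemma isCompact_closedCube (n : ℕ) : IsCompact (closedCube n) := by
  rw [closedCube_eq_preimage_Icc]
  exact (EuclideanSpace.equiv (Fin n) ℝ).toHomeomorph.isCompact_preimage.2 isCompact_Icc

lemma convex_closedCube (n : ℕ) : Convex ℝ (closedCube n) := by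
  rw [closedCube_eq_preimage_Icc]
  exact (convex_Icc _ _).linear_preimage (EuclideanSpace.equiv (Fin n) ℝ).toLinearMap

lemma isOpen_openCube (n : ℕ) : IsOpen (openCube n) := by
  rw [openCube, ofPred_forall]
  exact isOpen_iInter_of_finite fun i => isOpen_lt (by fun_prop) continuous_const

lemma openCube_subset_closedCube (n : ℕ) : openCube n ⊆ closedCube n := fun _ hx i => (hx i).le

lemma exists_abs_eq_one_of_mem_frontier {x : EuclideanSpace ℝ (Fin n)}
    (hx : x ∈ frontier (closedCube n)) : ∃ i, |x i| = 1 := by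
  have hclosed : x ∈ closedCube n := (isCompact_closedCube n).isClosed.frontier_subset hx
  by_contra! hne
  exact hx.2 (interior_maximal (openCube_subset_closedCube n) (isOpen_openCube n)
    fun i => (hclosed i).lt_of_ne (hne i))

lemma closedBall_subset_openCube {ρ : ℝ} (hρ : ρ < 1) : Metric.closedBall 0 ρ ⊆ openCube n := by
  intro x hx i
  exact (PiLp.norm_apply_le x i).trans_lt ((mem_closedBall_zero_iff.1 hx).trans_lt hρ)

lemma ae_apply {ι : Type*} [Fintype ι] (i : ι) {P : ℝ → Prop} (h : ∀ᵐ t, P t) :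
    ∀ᵐ x : EuclideanSpace ℝ ι, P (x i) :=
  ((Measure.quasiMeasurePreserving_eval (fun _ : ι => (volume : Measure ℝ)) i).comp
    (PiLp.volume_preserving_ofLp ι).quasiMeasurePreserving).ae h

lemma ae_mem_openCube (n : ℕ) : ∀ᵐ x ∂volume.restrict (closedCube n), x ∈ openCube n := by
  have hface : ∀ᵐ x : EuclideanSpace ℝ (Fin n), ∀ i, x i ≠ 1 ∧ x i ≠ -1 :=
    ae_all_iff.2 fun i => ae_apply i ((Measure.ae_ne volume 1).and (Measure.ae_ne volume (-1)))
  filter_upwards [ae_restrict_of_ae hface, ae_restrict_mem (isCompact_closedCube n).measurableSet]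
    with x hx hx_closed i
  refine (hx_closed i).lt_of_ne fun h => ?_
  rcases (abs_eq zero_le_one).1 h with h | h
  exacts [(hx i).1 h, (hx i).2 h]

end Cube

section CalculusLemmas

variable {E F : Type*} [NormedAddCommGroup E] [NormedSpace ℝ E] [NormedAddCommGroup F]
  [NormedSpace ℝ F]

lemma exists_holderOnWith_of_contDiff {f : E → F} (hf : ContDiff ℝ 1 f) {s : Set E}
    (hs : IsCompact s) (hs_convex : Convex ℝ s) {a : ℝ≥0} (ha : a ≤ 1) :
    ∃ C, HolderOnWith C a f s := by
  obtain ⟨L, hL⟩ := hf.contDiffOn.exists_lipschitzOnWith one_ne_zero hs_convex hs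
  refine ⟨_, HolderOnWith.of_le (D := (Metric.ediam s).toNNReal) (fun x hx y hy => ?_)
    (holderOnWith_one.2 hL) ha⟩
  rw [ENNReal.coe_toNNReal hs.isBounded.ediam_ne_top]
  exact Metric.edist_le_ediam_of_mem hx hy

lemma det_fderiv_sub_smul_const [FiniteDimensional ℝ E] {g : E → ℝ} {φ : E →L[ℝ] ℝ} {x : E}
    (hg : HasFDerivAt g φ x) (v : E) :
    DifferentiableAt ℝ (fun y => y - g y • v) x ∧
    (fderiv ℝ (fun y => y - g y • v) x).det = 1 - φ v := by
  have hderiv : HasFDerivAt (fun y => y - g y • v) (.id ℝ E - φ.smulRight v) x :=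
    (hasFDerivAt_id x).fun_sub (hg.smul_const v)
  refine ⟨hderiv.differentiableAt, ?_⟩
  have hdet := LinearMap.transvection.det (φ : E →ₗ[ℝ] ℝ) (-v)
  have hmap : ((.id ℝ E - φ.smulRight v : E →L[ℝ] E) : E →ₗ[ℝ] E) =
      LinearMap.transvection (φ : E →ₗ[ℝ] ℝ) (-v) := by
    ext y
    simp [LinearMap.transvection.apply, sub_eq_add_neg]
  rw [hderiv.fderiv, ContinuousLinearMap.det, hmap, hdet]
  simp [sub_eq_add_neg]

end CalculusLemmas

section AxialPerturbation

variable {n : ℕ} (i : Fin n)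

/-- A smooth weight on the cube that is constant in the `i`-th coordinate, positive inside, and
zero on the faces not orthogonal to the `i`-th axis. -/
noncomputable def lateralWeight (x : EuclideanSpace ℝ (Fin n)) : ℝ :=
  ∏ j ∈ Finset.univ.erase i, (1 - x j ^ 2)

lemma contDiff_lateralWeight : ContDiff ℝ 1 (lateralWeight i) := by
  unfold lateralWeight
  fun_prop

lemma fderiv_lateralWeight_single (x : EuclideanSpace ℝ (Fin n)) :
    fderiv ℝ (lateralWeight i) x (EuclideanSpace.single i 1) = 0 := by
  have hconst (t : ℝ) :
      lateralWeight i (x + t • EuclideanSpace.single i 1) = lateralWeight i x := by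
    refine Finset.prod_congr rfl fun j hj => ?_
    simp [(Finset.mem_erase.1 hj).1]
  rw [← ((contDiff_lateralWeight i).differentiable one_ne_zero x).lineDeriv_eq_fderiv, lineDeriv]
  simp only [hconst, deriv_const]

variable {i} {x : EuclideanSpace ℝ (Fin n)}

lemma lateralWeight_le_one (hx : x ∈ closedCube n) : lateralWeight i x ≤ 1 :=
  Finset.prod_le_one (fun j _ => sub_nonneg.2 ((sq_le_one_iff_abs_le_one _).2 (hx j)))
    fun _ _ => sub_le_self _ (sq_nonneg _)

lemma lateralWeight_pos (hx : x ∈ openCube n) : 0 < lateralWeight i x :=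
  Finset.prod_pos fun j _ => sub_pos.2 ((sq_lt_one_iff_abs_lt_one _).2 (hx j))

lemma lateralWeight_eq_zero {j : Fin n} (hj : j ≠ i) (hx : |x j| = 1) : lateralWeight i x = 0 := by
  refine Finset.prod_eq_zero (Finset.mem_erase.2 ⟨hj, Finset.mem_univ j⟩) ?_
  rw [← sq_abs, hx, one_pow, sub_self]

/-- The layered sum of `u` along the `i`-th axis. Its layers have higher and higher frequency
towards the lateral faces of the cube, where `lateralWeight i` vanishes. -/
noncomputable def axialPerturbation (i : Fin n) (u : ℝ → ℝ) (x : EuclideanSpace ℝ (Fin n)) : ℝ :=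
  layeredSum u (lateralWeight i x) (x i)

variable {u : ℝ → ℝ} {M a : ℝ≥0}

lemma axialPerturbation_zero (hu : ∀ m : ℤ, u m = 0) : axialPerturbation i u 0 = 0 := by
  simpa [axialPerturbation] using layeredSum_intCast hu (lateralWeight i 0) 0

lemma axialPerturbation_eq_zero_of_mem_frontier (hu : ∀ m : ℤ, u m = 0)
    (hx : x ∈ frontier (closedCube n)) : axialPerturbation i u x = 0 := by
  obtain ⟨j, hj⟩ := exists_abs_eq_one_of_mem_frontier hx
  rcases eq_or_ne j i with rfl | hji
  · rcases (abs_eq zero_le_one).1 hj with h | h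
    · simpa [axialPerturbation, h] using layeredSum_intCast hu (lateralWeight j x) 1
    · simpa [axialPerturbation, h] using layeredSum_intCast hu (lateralWeight j x) (-1)
  · rw [axialPerturbation, lateralWeight_eq_zero hji hj, layeredSum_zero_left]

lemma exists_holderOnWith_axialPerturbation (hu : ∀ x, |u x| ≤ M) (hu_holder : MemHolder a u)
    (ha : a < 1) : ∃ C, HolderOnWith C a (axialPerturbation i u) (closedCube n) := by
  obtain ⟨C, hC⟩ := memHolder_uncurry_layeredSum hu hu_holder ha
  have hcoord : ContDiff ℝ 1 fun x : EuclideanSpace ℝ (Fin n) => (lateralWeight i x, x i) :=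
    (contDiff_lateralWeight i).prodMk (by fun_prop)
  obtain ⟨L, hL⟩ := exists_holderOnWith_of_contDiff hcoord (isCompact_closedCube n)
    (convex_closedCube n) le_rfl
  have := hC.comp_holderOnWith hL
  rw [mul_one] at this
  exact ⟨_, this⟩

lemma exists_hasFDerivAt_axialPerturbation (hx : x ∈ openCube n)
    (hu : ∀ k : ℕ, HasDerivAt (rescale (4 ^ k) u) (-1) (x i)) :
    ∃ φ : EuclideanSpace ℝ (Fin n) →L[ℝ] ℝ,
      HasFDerivAt (axialPerturbation i u) φ x ∧ φ (EuclideanSpace.single i 1) = -1 := by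
  obtain ⟨A, hA⟩ := exists_hasFDerivAt_layeredSum (lateralWeight_pos hx)
    (lateralWeight_le_one (openCube_subset_closedCube n hx)) hu
  have hweight := ((contDiff_lateralWeight i).differentiable one_ne_zero x).hasFDerivAt
  have hcoord := (EuclideanSpace.proj i : EuclideanSpace ℝ (Fin n) →L[ℝ] ℝ).hasFDerivAt (x := x)
  refine ⟨_, HasFDerivAt.comp (f := fun y => (lateralWeight i y, y i)) x hA
    (hweight.prodMk hcoord), ?_⟩
  simp [fderiv_lateralWeight_single]

end AxialPerturbation

section PerturbedReflection

variable {n : ℕ}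

lemma norm_reflectFirst (x : EuclideanSpace ℝ (Fin n)) : ‖reflectFirst x‖ = ‖x‖ := by
  simp only [EuclideanSpace.norm_eq]
  congr! 3 with j
  by_cases hj : (j : ℕ) = 0 <;> simp [reflectFirst, hj]

variable [NeZero n]

lemma reflectFirst_eq_sub_smul (x : EuclideanSpace ℝ (Fin n)) :
    reflectFirst x = x - (2 * x 0) • EuclideanSpace.single 0 1 := by
  ext j
  rcases eq_or_ne j 0 with rfl | hj
  · simp [reflectFirst]
    ring
  · simp [reflectFirst, hj, Fin.val_eq_zero_iff]

lemma contDiff_reflectFirst : ContDiff ℝ (⊤ : ℕ∞) (reflectFirst (n := n)) := by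
  rw [funext reflectFirst_eq_sub_smul]
  fun_prop

lemma det_fderiv_reflectFirst (x : EuclideanSpace ℝ (Fin n)) :
    (fderiv ℝ reflectFirst x).det = -1 := by
  have hcoord := (EuclideanSpace.proj (0 : Fin n) : EuclideanSpace ℝ (Fin n) →L[ℝ] ℝ).hasFDerivAt
    (x := x)
  rw [funext reflectFirst_eq_sub_smul]
  refine (det_fderiv_sub_smul_const (hcoord.const_mul 2) _).2.trans ?_
  norm_num

/-- The reflection in the hyperplane `x 0 = 0`, perturbed along the normal axis so that, for a
sawtooth `u` of slope `-1`, the derivative in that direction becomes `-1 + 2 = 1`. -/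
noncomputable def perturbedReflection (u : ℝ → ℝ) (x : EuclideanSpace ℝ (Fin n)) :
    EuclideanSpace ℝ (Fin n) :=
  reflectFirst x - (2 * axialPerturbation 0 u x) • EuclideanSpace.single 0 1

variable {u : ℝ → ℝ} {M a : ℝ≥0} {x : EuclideanSpace ℝ (Fin n)}

lemma perturbedReflection_eq_sub_smul (u : ℝ → ℝ) (x : EuclideanSpace ℝ (Fin n)) :
    perturbedReflection u x =
      x - (2 * x 0 + 2 * axialPerturbation 0 u x) • EuclideanSpace.single 0 1 := by
  rw [perturbedReflection, reflectFirst_eq_sub_smul, sub_sub, ← add_smul]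

lemma perturbedReflection_zero (hu : ∀ m : ℤ, u m = 0) :
    perturbedReflection u (0 : EuclideanSpace ℝ (Fin n)) = 0 := by
  simp [perturbedReflection_eq_sub_smul, axialPerturbation_zero hu]

lemma perturbedReflection_eq_of_mem_frontier (hu : ∀ m : ℤ, u m = 0)
    (hx : x ∈ frontier (closedCube n)) : perturbedReflection u x = reflectFirst x := by
  rw [perturbedReflection, axialPerturbation_eq_zero_of_mem_frontier hu hx, mul_zero, zero_smul,
    sub_zero]

lemma norm_reflectFirst_sub_perturbedReflection_le (hu : ∀ x, |u x| ≤ M)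
    (x : EuclideanSpace ℝ (Fin n)) :
    ‖reflectFirst x - perturbedReflection u x‖ ≤ 2 * (M * (4 / 3)) := by
  rw [perturbedReflection, sub_sub_cancel, norm_smul, PiLp.norm_single, norm_one, mul_one,
    norm_mul, Real.norm_two]
  gcongr
  exact abs_layeredSum_le hu _ _

lemma exists_holderOnWith_perturbedReflection (hu : ∀ x, |u x| ≤ M) (hu_holder : MemHolder a u)
    (ha : a < 1) :
    ∃ C, HolderOnWith C a (perturbedReflection u) (closedCube n) := by
  obtain ⟨C₁, hC₁⟩ := exists_holderOnWith_of_contDiff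
    ((contDiff_reflectFirst (n := n)).of_le (by exact_mod_cast le_top))
    (isCompact_closedCube n) (convex_closedCube n) ha.le
  obtain ⟨C₂, hC₂⟩ := exists_holderOnWith_axialPerturbation (i := (0 : Fin n)) hu hu_holder ha
  let ℓ := ContinuousLinearMap.toSpanSingleton ℝ
    (-(2 : ℝ) • (EuclideanSpace.single 0 1 : EuclideanSpace ℝ (Fin n)))
  have hℓ := (holderWith_one.2 ℓ.lipschitz).comp_holderOnWith hC₂
  rw [one_mul] at hℓ
  have hsum : perturbedReflection u = reflectFirst + ℓ ∘ axialPerturbation (0 : Fin n) u := by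
    funext x
    simp only [perturbedReflection, ℓ, Pi.add_apply, comp_apply,
      ContinuousLinearMap.toSpanSingleton_apply]
    module
  exact hsum ▸ ⟨_, holderOnWith_add hC₁ hℓ⟩

lemma ae_det_fderiv_perturbedReflection (hu : ∀ᵐ x, HasDerivAt u (-1) x) :
    ∀ᵐ x ∂volume.restrict (closedCube n), DifferentiableAt ℝ (perturbedReflection u) x ∧
      (fderiv ℝ (perturbedReflection u) x).det = 1 := by
  have hrescale : ∀ᵐ t, ∀ k : ℕ, HasDerivAt (rescale (4 ^ k) u) (-1) t :=
    ae_all_iff.2 fun k => ae_hasDerivAt_rescale hu (by positivity)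
  filter_upwards [ae_mem_openCube n, ae_restrict_of_ae (ae_apply (0 : Fin n) hrescale)]
    with x hx hux
  obtain ⟨φ, hφ, hφ_axis⟩ := exists_hasFDerivAt_axialPerturbation hx hux
  have hcoord := (EuclideanSpace.proj 0 : EuclideanSpace ℝ (Fin n) →L[ℝ] ℝ).hasFDerivAt (x := x)
  obtain ⟨hdiff, hdet⟩ := det_fderiv_sub_smul_const
    ((hcoord.const_mul 2).fun_add (hφ.const_mul 2)) (EuclideanSpace.single 0 1)
  rw [funext (perturbedReflection_eq_sub_smul u)]
  refine ⟨hdiff, hdet.trans ?_⟩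
  simp [hφ_axis]

end PerturbedReflection

section Degree

variable {n : ℕ} {f : EuclideanSpace ℝ (Fin n) → EuclideanSpace ℝ (Fin n)} {ρ δ : ℝ}

lemma sub_le_norm_of_norm_reflectFirst_sub_le {x : EuclideanSpace ℝ (Fin n)}
    (h : ‖reflectFirst x - f x‖ ≤ δ) : ‖x‖ - δ ≤ ‖f x‖ := by
  have := norm_sub_norm_le (reflectFirst x) (f x)
  rw [norm_reflectFirst] at this
  linarith

variable [NeZero n]

lemma smoothDegree_reflectFirst (hρ : 0 < ρ) :
    smoothDegree reflectFirst (Metric.ball (0 : EuclideanSpace ℝ (Fin n)) ρ) 0 = -1 := by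
  have hpreimage : {x : EuclideanSpace ℝ (Fin n) | x ∈ Metric.ball 0 ρ ∧ reflectFirst x = 0} =
      {0} := by
    ext x
    rw [mem_ofPred_eq, ← norm_eq_zero, norm_reflectFirst, norm_eq_zero, mem_singleton_iff,
      and_iff_right_iff_imp]
    rintro rfl
    exact Metric.mem_ball_self hρ
  rw [smoothDegree, hpreimage, finsum_mem_singleton, det_fderiv_reflectFirst]
  simp

lemma hasBrouwerDegree_neg_one_of_norm_reflectFirst_sub_le (hρ : 0 < ρ) (hδ : 2 * δ < ρ)
    (hf : ∀ x ∈ Metric.closedBall 0 ρ, ‖reflectFirst x - f x‖ ≤ δ) :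
    HasBrouwerDegree f (Metric.ball 0 ρ) 0 (-1) := by
  have hsphere : (Metric.sphere (0 : EuclideanSpace ℝ (Fin n)) ρ).Nonempty :=
    ⟨EuclideanSpace.single 0 ρ, by simp [hρ.le]⟩
  have hdist : ρ - δ ≤ Metric.infDist 0 (f '' frontier (Metric.ball 0 ρ)) := by
    rw [frontier_ball _ hρ.ne', Metric.le_infDist (hsphere.image f), forall_mem_image]
    intro x hx
    have := sub_le_norm_of_norm_reflectFirst_sub_le (hf x (Metric.sphere_subset_closedBall hx))
    rwa [mem_sphere_zero_iff_norm.1 hx, ← dist_zero_left] at this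
  refine ⟨reflectFirst, contDiff_reflectFirst, fun x hx => ?_, fun x _ _ => ?_,
    smoothDegree_reflectFirst hρ⟩
  · linarith [hf x (Metric.closure_ball_subset_closedBall hx)]
  · rw [det_fderiv_reflectFirst]
    norm_num

lemma not_sensePreserving_of_norm_reflectFirst_sub_le (hρ₀ : 0 < ρ) (hρ : ρ < 1)
    (hδ : 2 * δ < ρ) (hf₀ : f 0 = 0)
    (hf : ∀ x ∈ Metric.closedBall 0 ρ, ‖reflectFirst x - f x‖ ≤ δ) :
    ¬ SensePreserving f (openCube n) := by
  intro hsense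
  have hclosure := closure_ball (0 : EuclideanSpace ℝ (Fin n)) hρ₀.ne'
  have hzero : (0 : EuclideanSpace ℝ (Fin n)) ∉ f '' frontier (Metric.ball 0 ρ) := by
    rw [frontier_ball _ hρ₀.ne']
    rintro ⟨x, hx, hfx⟩
    have := sub_le_norm_of_norm_reflectFirst_sub_le (hf x (Metric.sphere_subset_closedBall hx))
    rw [mem_sphere_zero_iff_norm.1 hx, hfx, norm_zero] at this
    linarith
  have hpos := hsense (Metric.ball 0 ρ) Metric.isOpen_ball (Metric.isConnected_ball hρ₀)
    (hclosure ▸ isCompact_closedBall 0 ρ) (hclosure ▸ closedBall_subset_openCube hρ) 0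
    ⟨⟨0, Metric.mem_ball_self hρ₀, hf₀⟩, hzero⟩ (-1)
    (hasBrouwerDegree_neg_one_of_norm_reflectFirst_sub_le hρ₀ hδ hf)
  norm_num at hpos

end Degree

theorem theorem1p3_general (n : ℕ) (hn : 0 < n) (s : ℝ) (hs : s < 1) (p : ℝ) (hp : 0 < p) :
    ∃ f : EuclideanSpace ℝ (Fin n) → EuclideanSpace ℝ (Fin n),
      ContinuousOn f (closedCube n) ∧
      MemFracSobolev s p (closedCube n) f ∧
      (∀ᵐ x ∂(volume.restrict (closedCube n)),
        DifferentiableAt ℝ f x ∧ (fderiv ℝ f x).det = 1) ∧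
      (∀ x ∈ frontier (closedCube n), f x = reflectFirst x) ∧
      ¬ SensePreserving f (openCube n) := by
  have : NeZero n := ⟨hn.ne'⟩
  obtain ⟨a, hsa, ha1⟩ := exists_between (max_lt hs one_pos)
  obtain ⟨hsa, ha⟩ := max_lt_iff.1 hsa
  lift a to ℝ≥0 using ha.le
  norm_cast at ha ha1
  obtain ⟨u, hu_holder, hu, hu_int, hu_deriv⟩ :=
    exists_holder_ae_hasDerivAt_neg_one ha ha1 (ε := (1 / 16 : ℝ≥0)) (by norm_num)
  obtain ⟨C, hC⟩ := exists_holderOnWith_perturbedReflection (n := n) hu hu_holder ha1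
  refine ⟨perturbedReflection u, hC.continuousOn ha,
    memFracSobolev_of_holderOnWith hn hp ha hsa hC (isCompact_closedCube n),
    ae_det_fderiv_perturbedReflection hu_deriv,
    fun x hx => perturbedReflection_eq_of_mem_frontier hu_int hx,
    not_sensePreserving_of_norm_reflectFirst_sub_le (ρ := 1 / 2) (by norm_num) (by norm_num) ?_
      (perturbedReflection_zero hu_int)
      fun x _ => norm_reflectFirst_sub_perturbedReflection_le hu x⟩
  norm_num

theorem theorem1p3 (n : ℕ) (hn : 2 ≤ n) (s : ℝ) (hs : s ∈ Set.Ioo (0 : ℝ) 1)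
    (p : ℝ) (hp : 1 < p) :
    ∃ f : EuclideanSpace ℝ (Fin n) → EuclideanSpace ℝ (Fin n),
      ContinuousOn f (closedCube n) ∧
      MemFracSobolev s p (closedCube n) f ∧
      (∀ᵐ x ∂(volume.restrict (closedCube n)),
        DifferentiableAt ℝ f x ∧ 0 < (fderiv ℝ f x).det) ∧
      (∀ x ∈ frontier (closedCube n), f x = reflectFirst x) ∧
      ¬ SensePreserving f (openCube n) := by
  obtain ⟨f, hf, hf_sob, hf_det, hf'⟩ :=
    theorem1p3_general n (by omega) s hs.2 p (zero_lt_one.trans hp)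
  exact ⟨f, hf, hf_sob, hf_det.mono fun x hx => ⟨hx.1, hx.2 ▸ one_pos⟩, hf'⟩
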